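/- Let $m\ge 0$ and $n\ge 1$ be integers and let $s$ be a real number with $2m<s<n$. Let $G(n,m)$ be the Grassmannian of $m$-dimensional linear subspaces of $\mathbb{R}^n$, and let $\gamma_{n,m}$ be the rotation-invariant (Haar) Borel probability measure on $G(n,m)$, that is, the image of the normalized Haar measure of the orthogonal group $O(n)$ under $g\mapsto gV_0$, where $V_0\in G(n,m)$ is a fixed subspace. For $V\in G(n,m)$ let $P_V\colon\mathbb{R}^n\to V$ be the orthogonal projection. Let $\mu$ be a Borel measure on $\mathbb{R}^n$ with $0<\mu(\mathbb{R}^n)<\infty$, with compact support $\operatorname{spt}\mu$, and with finite $s$-energy $$I_s(\mu)=\iint |x-y|^{-s}\,d\mu(x)\,d\mu(y)<\infty .$$ Then $$\gamma_{n,m}\bigl(\{V\in G(n,m): 0\in\operatorname{Int}(P_V(\operatorname{spt}\mu))\}\bigr)>0,$$ where $\operatorname{Int}$ denotes the interior relative to $V$. -/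

import Mathlib

open MeasureTheory

noncomputable section

namespace RieszProj

/-- Euclidean space `ℝⁿ`. -/
abbrev E (n : ℕ) : Type := EuclideanSpace ℝ (Fin n)

/-- The `s`-energy `I_s(μ) = ∬ |x - y|^{-s} dμ(x) dμ(y)`, an element of `[0, ∞]`;
for `s > 0` the kernel is `∞` on the diagonal. -/
def energy {n : ℕ} (s : ℝ) (μ : Measure (E n)) : ENNReal :=
  ∫⁻ x, ∫⁻ y, edist x y ^ (-s) ∂μ ∂μ

/-- `G(n,m)`: the `m`-dimensional linear subspaces of `ℝⁿ`. -/
def Gr (n m : ℕ) : Type := {V : Submodule ℝ (E n) // Module.finrank ℝ V = m}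

/-- The usual topology of `G(n,m)`, given by the metric `‖P_V - P_W‖`. -/
instance (n m : ℕ) : TopologicalSpace (Gr n m) :=
  TopologicalSpace.induced (fun V => V.1.starProjection) inferInstance

instance (n m : ℕ) : MeasurableSpace (Gr n m) := borel _

instance (n m : ℕ) : BorelSpace (Gr n m) := ⟨rfl⟩

/-- The orthogonal group `O(n)`, with its topology as a set of matrices. -/
abbrev O (n : ℕ) := Matrix.orthogonalGroup (Fin n) ℝ

instance (n : ℕ) : MeasurableSpace (O n) := borel _

instance (n : ℕ) : BorelSpace (O n) := ⟨rfl⟩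

instance (n : ℕ) : CompactSpace (O n) := by
  refine (isCompact_iff_compactSpace
    (s := (Matrix.orthogonalGroup (Fin n) ℝ : Set (Matrix (Fin n) (Fin n) ℝ)))).mp ?_
  have hK : IsCompact (Set.pi Set.univ fun _ : Fin n =>
      Set.pi Set.univ fun _ : Fin n => Set.Icc (-1 : ℝ) 1) :=
    isCompact_univ_pi fun _ => isCompact_univ_pi fun _ => isCompact_Icc
  refine hK.of_isClosed_subset ?_ ?_
  · have h : ((Matrix.orthogonalGroup (Fin n) ℝ : Set (Matrix (Fin n) (Fin n) ℝ)))
        = {A | A * star A = 1} := by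
      ext A; exact Matrix.mem_unitaryGroup_iff
    exact h ▸ isClosed_eq (by fun_prop) continuous_const
  · intro A hA i _ j _
    have h := entry_norm_bound_of_unitary hA i j
    rw [Real.norm_eq_abs] at h
    exact abs_le.mp h

/-- The normalized Haar measure `θ_n` of `O(n)`. -/
def haarO (n : ℕ) : Measure (O n) := Measure.haarMeasure ⊤

instance (n : ℕ) : IsProbabilityMeasure (haarO n) :=
  ⟨Measure.haarMeasure_self (K₀ := (⊤ : TopologicalSpace.PositiveCompacts (O n)))⟩

/-- The image `gV` of the subspace `V` under `g ∈ O(n)`. -/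
def rotate {n : ℕ} (g : O n) (V : Submodule ℝ (E n)) : Submodule ℝ (E n) :=
  V.map (Matrix.toEuclideanLin (g : Matrix (Fin n) (Fin n) ℝ))

theorem toEuclideanLin_injective {n : ℕ} (g : O n) :
    Function.Injective (Matrix.toEuclideanLin (g : Matrix (Fin n) (Fin n) ℝ)) := by
  intro x y h
  have h1 : (g : Matrix (Fin n) (Fin n) ℝ).mulVec x.ofLp
      = (g : Matrix (Fin n) (Fin n) ℝ).mulVec y.ofLp := congrArg WithLp.ofLp h
  have h2 := congrArg (star (g : Matrix (Fin n) (Fin n) ℝ)).mulVec h1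
  rw [Matrix.mulVec_mulVec, Matrix.mulVec_mulVec, Unitary.coe_star_mul_self,
    Matrix.one_mulVec, Matrix.one_mulVec] at h2
  exact WithLp.ofLp_injective 2 h2

/-- The action of `g ∈ O(n)` on `G(n,m)`. -/
def Gr.rotate {n m : ℕ} (g : O n) (V : Gr n m) : Gr n m :=
  ⟨RieszProj.rotate g V.1,
    (Submodule.equivMapOfInjective _ (toEuclideanLin_injective g) V.1).finrank_eq.symm.trans V.2⟩

/-- The coordinate subspace `V₀ = span {e_1, …, e_m}` of `ℝⁿ`, for `m ≤ n`. -/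
def Gr.base {n m : ℕ} (h : m ≤ n) : Gr n m :=
  ⟨Submodule.span ℝ (Set.range fun i : Fin m =>
      EuclideanSpace.single (Fin.castLE h i) (1 : ℝ)), by
    have hl : LinearIndependent ℝ fun i : Fin m =>
        (EuclideanSpace.single (Fin.castLE h i) (1 : ℝ) : E n) := by
      have := (EuclideanSpace.orthonormal_single (𝕜 := ℝ) (ι := Fin n)).comp
        _ (Fin.castLE_injective h)
      exact this.linearIndependent
    rw [finrank_span_eq_card hl, Fintype.card_fin]⟩

theorem starProjection_map_of_unitary {n : ℕ} (A B : E n →L[ℝ] E n)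
    (hB : B = ContinuousLinearMap.adjoint A) (h1 : A * B = 1) (h2 : B * A = 1)
    (V : Submodule ℝ (E n)) :
    (V.map (A : E n →ₗ[ℝ] E n)).starProjection = A.comp (V.starProjection.comp B) := by
  ext1 x
  refine Submodule.eq_starProjection_of_mem_of_inner_eq_zero
    (Submodule.mem_map_of_mem (Submodule.starProjection_apply_mem _ _)) ?_
  rintro _ ⟨w, hw, rfl⟩
  have hx : A (B x) = x := DFunLike.congr_fun h1 x
  have h2' : ∀ z, B (A z) = z := fun z => DFunLike.congr_fun h2 z
  change inner ℝ (x - A (V.starProjection (B x))) (A w) = 0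
  rw [← ContinuousLinearMap.adjoint_inner_left, ← hB, map_sub, h2']
  exact Submodule.starProjection_inner_eq_zero _ _ hw

/-- `g ↦ gV` is continuous, since `P_{gV} = g P_V g⁻¹`; so the image measure below makes sense. -/
theorem Gr.continuous_rotate {n m : ℕ} (V : Gr n m) : Continuous fun g : O n => Gr.rotate g V := by
  rw [continuous_induced_rng]
  let T : Matrix (Fin n) (Fin n) ℝ →ₗ[ℝ] (E n →L[ℝ] E n) :=
    (Matrix.toEuclideanCLM (n := Fin n) (𝕜 := ℝ)).toAlgEquiv.toLinearMap
  have hT : Continuous T := T.continuous_of_finiteDimensional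
  have hmul : ∀ A B, T (A * B) = T A * T B :=
    map_mul (Matrix.toEuclideanCLM (n := Fin n) (𝕜 := ℝ))
  have hone : T 1 = 1 := map_one (Matrix.toEuclideanCLM (n := Fin n) (𝕜 := ℝ))
  have hstar : ∀ A, T (star A) = ContinuousLinearMap.adjoint (T A) :=
    map_star (Matrix.toEuclideanCLM (n := Fin n) (𝕜 := ℝ))
  have h1 : Continuous fun g : O n => T g.1 := hT.comp continuous_subtype_val
  have h2 : Continuous fun g : O n => T (star g.1) := hT.comp continuous_subtype_val.star
  refine (h1.clm_comp ((continuous_const (y := V.1.starProjection)).clm_comp h2)).congr fun g => ?_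
  exact (starProjection_map_of_unitary (T g.1) (T (star g.1)) (hstar _)
    (by rw [← hmul, Unitary.mul_star_self_of_mem g.2, hone])
    (by rw [← hmul, Unitary.star_mul_self_of_mem g.2, hone]) V.1).symm

/-- The rotation-invariant probability measure `γ_{n,m}` on `G(n,m)`: the image of the normalized
Haar measure of `O(n)` under `g ↦ g V₀`. For `m > n`, where `G(n,m)` is empty, it is `0`. -/
def gammaGr (n m : ℕ) : Measure (Gr n m) :=
  if h : m ≤ n then (haarO n).map fun g => Gr.rotate g (Gr.base h) else 0

theorem isProbabilityMeasure_gammaGr {n m : ℕ} (h : m ≤ n) :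
    IsProbabilityMeasure (gammaGr n m) := by
  rw [gammaGr, dif_pos h]
  exact Measure.isProbabilityMeasure_map (Gr.continuous_rotate _).measurable.aemeasurable

end RieszProj

end

/-! Write $\hat\mu$ for `charFun μ`. The image of $\mu$ under $P_V$ has as its Fourier transform the
restriction of $\hat\mu$ to $V$. If this restriction is integrable, Fourier inversion gives the
image measure a continuous density whose value at $0$ is a positive multiple of $\int_V\hat\mu$. If
that integral is nonzero, the density is nonzero near $0$, and a neighborhood of $0$ lies in
$P_V(\operatorname{spt}\mu)$.

It remains to find many such $V$. In polar coordinates, averaging $\int_{gV_0}\hat\mu$ over $g\in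
O(n)$ gives $c\int|\xi|^{m-n}\hat\mu(\xi)\,d\xi$ (`exists_map_act_eq`). This integral converges
absolutely: finite energy gives $\int|\xi|^{s-n}|\hat\mu|^2<\infty$, and $s>2m$ leaves enough decay
at infinity to pair with it (`integrable_rpow_norm_mul_charFun`). For $m>0$ it is a positive
multiple of the Riesz potential $\int|y|^{-m}\,d\mu(y)$. Only its nonvanishing is needed, and this
follows by writing $|\xi|^{m-n}$ as a mixture of Gaussians
(`integral_rpow_norm_mul_charFun_ne_zero`). A nonzero average cannot come from integrals that vanish
for almost every $g$. -/

section Analysis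

open Set Filter Topology

variable {V : Type*} [NormedAddCommGroup V] [InnerProductSpace ℝ V] [FiniteDimensional ℝ V]
  [MeasurableSpace V] [BorelSpace V]

/-! ### Radial integrals and Gaussian pairings. -/

/-- Polar coordinates for the lower Lebesgue integral of a radial function. -/
theorem lintegral_fun_norm_addHaar [Nontrivial V] {f : ℝ → ENNReal} (hf : Measurable f) :
    ∫⁻ x : V, f ‖x‖ = (volume : Measure V).toSphere univ *
      ∫⁻ r in Ioi (0 : ℝ), ENNReal.ofReal (r ^ (Module.finrank ℝ V - 1)) * f r := by
  calc
    ∫⁻ x : V, f ‖x‖ = ∫⁻ x : ({(0)}ᶜ : Set V), f ‖x.1‖ ∂((volume : Measure V).comap (↑)) := by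
      rw [lintegral_subtype_comap (measurableSet_singleton _).compl fun x : V ↦ f ‖x‖,
        restrict_compl_singleton]
    _ = ∫⁻ x : Metric.sphere (0 : V) 1 × Ioi (0 : ℝ), f x.2
          ∂(volume : Measure V).toSphere.prod (.volumeIoiPow (Module.finrank ℝ V - 1)) := by
      have := (volume : Measure V).measurePreserving_homeomorphUnitSphereProd.lintegral_comp_emb
        (Homeomorph.measurableEmbedding _) (fun x => f x.2)
      simpa using this
    _ = (volume : Measure V).toSphere univ *
          ∫⁻ x : Ioi (0 : ℝ), f x ∂.volumeIoiPow (Module.finrank ℝ V - 1) := by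
      rw [lintegral_prod _ (by fun_prop)]
      simp [mul_comm]
    _ = _ := by
      rw [Measure.volumeIoiPow, lintegral_withDensity_eq_lintegral_mul _ (by fun_prop)
        (by fun_prop)]
      congr 1
      exact lintegral_subtype_comap measurableSet_Ioi
        (fun r : ℝ => ENNReal.ofReal (r ^ (Module.finrank ℝ V - 1)) * f r)

theorem integrable_exp_neg_mul_sq_norm {b : ℝ} (hb : 0 < b) :
    Integrable fun u : V => Real.exp (-b * ‖u‖ ^ 2) := by
  refine Integrable.of_integral_ne_zero ?_
  rw [GaussianFourier.integral_rexp_neg_mul_sq_norm hb]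
  positivity

/-- The Fourier transform of a Gaussian, paired with a finite measure. -/
theorem integral_charFun_mul_exp_neg_mul_sq (ν : Measure V) [IsFiniteMeasure ν] {b : ℝ}
    (hb : 0 < b) (x : V) :
    ∫ u, charFun ν u * Complex.exp (-(inner ℝ x u * Complex.I)) * (Real.exp (-b * ‖u‖ ^ 2) : ℝ) =
      (((Real.pi / b) ^ (Module.finrank ℝ V / 2 : ℝ) *
        ∫ y, Real.exp (-(‖y - x‖ ^ 2 / (4 * b))) ∂ν : ℝ) : ℂ) := by
  have h1 : ∀ u : V, charFun ν u * Complex.exp (-(inner ℝ x u * Complex.I)) *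
      (Real.exp (-b * ‖u‖ ^ 2) : ℝ) =
      ∫ y, Complex.exp (-b * ‖u‖ ^ 2 + Complex.I * (inner ℝ (y - x) u : ℝ)) ∂ν := by
    intro u
    rw [charFun_apply, ← integral_mul_const, ← integral_mul_const]
    congr 1 with y
    rw [Complex.ofReal_exp, ← Complex.exp_add, ← Complex.exp_add, inner_sub_left]
    congr 1
    push_cast
    ring
  have h2 : ∀ y : V, ∫ u, Complex.exp (-b * ‖u‖ ^ 2 + Complex.I * (inner ℝ (y - x) u : ℝ)) =
      (((Real.pi / b) ^ (Module.finrank ℝ V / 2 : ℝ) *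
        Real.exp (-(‖y - x‖ ^ 2 / (4 * b))) : ℝ) : ℂ) := by
    intro y
    rw [GaussianFourier.integral_cexp_neg_mul_sq_norm_add (by simpa using hb)]
    rw [Complex.ofReal_mul, Complex.ofReal_cpow (by positivity), Complex.ofReal_exp]
    congr 2
    · push_cast; ring
    · push_cast; ring
    · rw [Complex.I_sq]; push_cast; ring
  simp_rw [h1]
  rw [integral_integral_swap]
  · simp_rw [h2]
    rw [integral_complex_ofReal, integral_const_mul]
  · have h3 : Integrable (fun p : V × V => Real.exp (-b * ‖p.1‖ ^ 2)) (volume.prod ν) := by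
      simpa using (integrable_exp_neg_mul_sq_norm (V := V) hb).mul_prod
        (integrable_const (μ := ν) (1 : ℝ))
    refine h3.mono' (Continuous.aestronglyMeasurable (by fun_prop)) (ae_of_all _ fun p => ?_)
    simp only [Function.uncurry]
    rw [Complex.norm_exp]
    simp [← Complex.ofReal_pow, ← Complex.ofReal_mul]

/-! ### Fourier inversion and interior points of the support. -/

/-- If the characteristic function is integrable, the Fourier inversion integral vanishes off the
support. -/
theorem integral_charFun_mul_exp_eq_zero (ν : Measure V) [IsFiniteMeasure ν]
    (hν : Integrable (charFun ν)) {x : V} {δ : ℝ} (hδ : 0 < δ) (hx : ν (Metric.ball x δ) = 0) :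
    ∫ u, charFun ν u * Complex.exp (-(inner ℝ x u * Complex.I)) = 0 := by
  set d : ℝ := Module.finrank ℝ V / 2
  -- Regularize by $e^{-|u|^2/t}$ and let $t\to\infty$.
  have hlim : Tendsto (fun t : ℝ => ∫ u, charFun ν u * Complex.exp (-(inner ℝ x u * Complex.I)) *
      (Real.exp (-t⁻¹ * ‖u‖ ^ 2) : ℝ)) atTop
      (𝓝 (∫ u, charFun ν u * Complex.exp (-(inner ℝ x u * Complex.I)))) := by
    refine tendsto_integral_filter_of_dominated_convergence (fun u => ‖charFun ν u‖) ?_ ?_ hν.norm ?_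
    · exact Eventually.of_forall fun t => by
        refine Measurable.aestronglyMeasurable ?_
        fun_prop
    · filter_upwards [eventually_gt_atTop 0] with t ht
      refine ae_of_all _ fun u => ?_
      rw [norm_mul, norm_mul, Complex.norm_exp]
      have h1 : Real.exp (-t⁻¹ * ‖u‖ ^ 2) ≤ 1 := by
        rw [Real.exp_le_one_iff]
        have : 0 < t⁻¹ := inv_pos.2 ht
        nlinarith [sq_nonneg ‖u‖]
      have h2 : ‖((Real.exp (-t⁻¹ * ‖u‖ ^ 2) : ℝ) : ℂ)‖ ≤ 1 := by
        rw [Complex.norm_real, Real.norm_of_nonneg (Real.exp_nonneg _)]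
        exact h1
      simpa using mul_le_mul_of_nonneg_left h2 (norm_nonneg (charFun ν u))
    · refine ae_of_all _ fun u => ?_
      have h1 : Tendsto (fun t : ℝ => Real.exp (-t⁻¹ * ‖u‖ ^ 2)) atTop (𝓝 1) := by
        have : Tendsto (fun t : ℝ => -t⁻¹ * ‖u‖ ^ 2) atTop (𝓝 (-0 * ‖u‖ ^ 2)) :=
          (tendsto_inv_atTop_zero.neg).mul_const _
        simpa [Function.comp_def] using (Real.continuous_exp.tendsto _).comp this
      have h2 := ((Complex.continuous_ofReal.tendsto _).comp h1).const_mul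
        (charFun ν u * Complex.exp (-(inner ℝ x u * Complex.I)))
      simpa using h2
  -- The regularized integral is $(\pi t)^d\int e^{-t|y-x|^2/4}\,d\nu(y)$ with $d$ half the
  -- dimension. Since $\nu$ lives at distance at least $\delta$ from $x$, the exponential beats the
  -- power.
  have hlim0 : Tendsto (fun t : ℝ => ∫ u, charFun ν u * Complex.exp (-(inner ℝ x u * Complex.I)) *
      (Real.exp (-t⁻¹ * ‖u‖ ^ 2) : ℝ)) atTop (𝓝 0) := by
    have hg : Tendsto (fun t : ℝ => (Real.pi ^ d * ν.real univ) *
        (t ^ d * Real.exp (-(δ ^ 2 / 4) * t))) atTop (𝓝 0) := by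
      simpa using (tendsto_rpow_mul_exp_neg_mul_atTop_nhds_zero d (δ ^ 2 / 4)
        (by positivity)).const_mul (Real.pi ^ d * ν.real univ)
    refine squeeze_zero_norm' ?_ hg
    filter_upwards [eventually_gt_atTop 0] with t ht
    rw [integral_charFun_mul_exp_neg_mul_sq ν (inv_pos.2 ht) x, Complex.norm_real,
      Real.norm_of_nonneg (by positivity)]
    have h1 : ∫ y, Real.exp (-(‖y - x‖ ^ 2 / (4 * t⁻¹))) ∂ν ≤
        ∫ _, Real.exp (-(δ ^ 2 / 4) * t) ∂ν := by
      refine integral_mono_of_nonneg (ae_of_all _ fun y => (Real.exp_nonneg _))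
        (integrable_const _) ?_
      have : ∀ᵐ y ∂ν, y ∉ Metric.ball x δ := measure_eq_zero_iff_ae_notMem.1 hx
      filter_upwards [this] with y hy
      rw [Metric.mem_ball, not_lt, dist_eq_norm] at hy
      rw [Real.exp_le_exp]
      have h2 : δ ^ 2 ≤ ‖y - x‖ ^ 2 := by gcongr
      have h3 : ‖y - x‖ ^ 2 / (4 * t⁻¹) = ‖y - x‖ ^ 2 / 4 * t := by field_simp
      rw [h3]
      nlinarith
    rw [integral_const, smul_eq_mul] at h1
    calc _ ≤ (Real.pi / t⁻¹) ^ d * (ν.real univ * Real.exp (-(δ ^ 2 / 4) * t)) := by gcongr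
      _ = _ := by
        rw [div_inv_eq_mul, Real.mul_rpow Real.pi_pos.le ht.le]; ring
  exact tendsto_nhds_unique hlim hlim0

/-- If the density of `ν`, given by Fourier inversion, does not vanish at `0`, then `0` is
interior to every closed set carrying `ν`. -/
theorem zero_mem_interior_of_integral_charFun_ne_zero (ν : Measure V) [IsFiniteMeasure ν]
    (hν : Integrable (charFun ν)) (h0 : ∫ u, charFun ν u ≠ 0) {K : Set V} (hK : IsClosed K)
    (hνK : ν Kᶜ = 0) : (0 : V) ∈ interior K := by
  have hc : Continuous fun x : V =>
      ∫ u, charFun ν u * Complex.exp (-(inner ℝ x u * Complex.I)) := by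
    refine continuous_of_dominated (bound := fun u => ‖charFun ν u‖) (fun x => ?_) (fun x => ?_)
      hν.norm ?_
    · exact Measurable.aestronglyMeasurable (by fun_prop)
    · refine ae_of_all _ fun u => ?_
      rw [norm_mul, Complex.norm_exp]
      simp
    · exact ae_of_all _ fun u => by fun_prop
  rw [mem_interior_iff_mem_nhds]
  filter_upwards [hc.continuousAt.eventually_ne (x := (0 : V)) (y := 0) (by simpa using h0)]
    with x hx
  by_contra hxK
  obtain ⟨δ, hδ, hball⟩ := Metric.isOpen_iff.1 hK.isOpen_compl x hxK
  exact hx (integral_charFun_mul_exp_eq_zero ν hν hδ (measure_mono_null hball hνK))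

/-! ### The energy on the Fourier side. -/

theorem lintegral_rpow_mul_exp_neg_mul {a r : ℝ} (ha : 0 < a) (hr : 0 < r) :
    ∫⁻ t in Ioi (0 : ℝ), ENNReal.ofReal (t ^ (a - 1) * Real.exp (-(r * t))) =
      ENNReal.ofReal ((1 / r) ^ a * Real.Gamma a) := by
  rw [← Real.integral_rpow_mul_exp_neg_mul_Ioi ha hr, ofReal_integral_eq_lintegral_ofReal]
  · refine Integrable.of_integral_ne_zero ?_
    rw [Real.integral_rpow_mul_exp_neg_mul_Ioi ha hr]
    have := Real.Gamma_pos_of_pos ha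
    positivity
  · filter_upwards [ae_restrict_mem measurableSet_Ioi] with t ht
    have : (0 : ℝ) < t := ht
    positivity

/-- On $(r^2,2r^2]$, an interval of length $r^2$, the integrand is at least $(2r^2)^a e^{-1}$. A
lower bound of the right order suffices, so the exact Gamma value is not computed. -/
theorem le_lintegral_rpow_mul_exp_neg_div {a r : ℝ} (ha : a ≤ 0) (hr : 0 < r) :
    ENNReal.ofReal (2 ^ a * Real.exp (-1) * r ^ (2 * a + 2)) ≤
      ∫⁻ t in Ioi (0 : ℝ), ENNReal.ofReal (t ^ a * Real.exp (-t⁻¹ * r ^ 2)) := by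
  have h1 : ENNReal.ofReal (2 ^ a * Real.exp (-1) * r ^ (2 * a + 2)) =
      ∫⁻ _ in Ioc (r ^ 2) (2 * r ^ 2), ENNReal.ofReal ((2 * r ^ 2) ^ a * Real.exp (-1)) := by
    rw [setLIntegral_const, Real.volume_Ioc, ← ENNReal.ofReal_mul (by positivity)]
    congr 1
    rw [Real.mul_rpow (by norm_num) (by positivity), Real.rpow_add hr, Real.rpow_mul hr.le]
    norm_num
    ring
  rw [h1]
  refine (setLIntegral_mono' measurableSet_Ioc fun t ht => ?_).trans
    (lintegral_mono_set fun t ht => (by positivity : 0 < r ^ 2).trans ht.1)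
  have ht0 : 0 < t := (by positivity : 0 < r ^ 2).trans ht.1
  refine ENNReal.ofReal_le_ofReal ?_
  have h2 : (2 * r ^ 2) ^ a ≤ t ^ a := Real.rpow_le_rpow_of_nonpos ht0 ht.2 ha
  have h3 : Real.exp (-1) ≤ Real.exp (-t⁻¹ * r ^ 2) := by
    rw [Real.exp_le_exp, neg_mul, neg_le_neg_iff, inv_mul_le_iff₀ ht0, mul_one]
    exact ht.1.le
  gcongr

theorem charFun_conv_map_neg (μ : Measure V) [IsFiniteMeasure μ] (ξ : V) :
    charFun (μ.conv (μ.map fun x => -x)) ξ = ((‖charFun μ ξ‖ ^ 2 : ℝ) : ℂ) := by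
  rw [charFun_conv]
  have : charFun (μ.map fun x => -x) ξ = (starRingEnd ℂ) (charFun μ ξ) := by
    rw [← charFun_neg]
    simpa using charFun_map_smul (μ := μ) (-1 : ℝ) ξ
  rw [this, Complex.mul_conj, Complex.normSq_eq_norm_sq]

/-- $|\hat\mu|^2$ is the transform of $\mu$ convolved with its reflection, so the Gaussian pairing
applies to it at $x=0$, $b=t^{-1}$. -/
theorem lintegral_norm_charFun_sq_mul_exp (μ : Measure V) [IsFiniteMeasure μ] {t : ℝ}
    (ht : 0 < t) :
    ∫⁻ ξ, ENNReal.ofReal (‖charFun μ ξ‖ ^ 2 * Real.exp (-t⁻¹ * ‖ξ‖ ^ 2)) =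
      ENNReal.ofReal ((Real.pi * t) ^ (Module.finrank ℝ V / 2 : ℝ)) *
        ∫⁻ x, ∫⁻ y, ENNReal.ofReal (Real.exp (-(‖x - y‖ ^ 2 / 4 * t))) ∂μ ∂μ := by
  have h := integral_charFun_mul_exp_neg_mul_sq (μ.conv (μ.map fun x => -x)) (inv_pos.2 ht) 0
  simp_rw [charFun_conv_map_neg] at h
  simp only [inner_zero_left, Complex.ofReal_zero, zero_mul, neg_zero, Complex.exp_zero, mul_one,
    sub_zero, ← Complex.ofReal_mul, integral_complex_ofReal, Complex.ofReal_inj] at h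
  rw [← ofReal_integral_eq_lintegral_ofReal _ (ae_of_all _ fun _ => by positivity), h,
    ENNReal.ofReal_mul (by positivity), ofReal_integral_eq_lintegral_ofReal _
      (ae_of_all _ fun _ => by positivity), Measure.lintegral_conv (by fun_prop), div_inv_eq_mul]
  · congr 1
    refine lintegral_congr fun x => ?_
    rw [lintegral_map (by fun_prop) (by fun_prop)]
    refine lintegral_congr fun y => ?_
    congr 3
    rw [← sub_eq_add_neg]
    field_simp
  · refine (integrable_const (1 : ℝ)).mono' (by fun_prop) (ae_of_all _ fun y => ?_)
    rw [Real.norm_of_nonneg (by positivity), Real.exp_le_one_iff, neg_nonpos]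
    positivity
  · refine ((integrable_exp_neg_mul_sq_norm (inv_pos.2 ht)).const_mul (μ.real univ ^ 2)).mono'
      (Measurable.aestronglyMeasurable (by fun_prop)) (ae_of_all _ fun y => ?_)
    rw [Real.norm_of_nonneg (by positivity)]
    have := norm_charFun_le (μ := μ) y
    gcongr

/-- Finite `s`-energy makes `|ξ|^{(s-d)/2} μ̂(ξ)` square integrable. -/
theorem lintegral_norm_charFun_sq_mul_rpow_lt_top [Nontrivial V] (μ : Measure V)
    [IsFiniteMeasure μ] {s : ℝ} (hs : 0 < s) (hsd : s < Module.finrank ℝ V)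
    (hE : ∫⁻ x, ∫⁻ y, edist x y ^ (-s) ∂μ ∂μ < ⊤) :
    ∫⁻ ξ, ENNReal.ofReal (‖charFun μ ξ‖ ^ 2 * ‖ξ‖ ^ (s - Module.finrank ℝ V)) < ⊤ := by
  set d : ℝ := (Module.finrank ℝ V : ℝ) with hd
  -- Then $2a+2=s-d$, and $a+d/2=s/2-1$: the factor $t^{d/2}$ of the Gaussian pairing turns $t^a$
  -- into the weight of the Gamma integral for $|x-y|^{-s}$.
  set a : ℝ := (s - d) / 2 - 1 with ha
  set C : ℝ := 2 ^ a * Real.exp (-1) with hC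
  have hC0 : 0 < C := by positivity
  have h1 : ENNReal.ofReal C * ∫⁻ ξ, ENNReal.ofReal (‖charFun μ ξ‖ ^ 2 * ‖ξ‖ ^ (s - d)) ≤
      ∫⁻ ξ, ∫⁻ t in Ioi (0 : ℝ), ENNReal.ofReal (t ^ a) *
        ENNReal.ofReal (‖charFun μ ξ‖ ^ 2 * Real.exp (-t⁻¹ * ‖ξ‖ ^ 2)) := by
    rw [← lintegral_const_mul _ (by fun_prop)]
    refine lintegral_mono_ae ?_
    filter_upwards [Measure.ae_ne volume (0 : V)] with ξ hξ
    have h := le_lintegral_rpow_mul_exp_neg_div (a := a) (by linarith) (norm_pos_iff.2 hξ)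
    have h' : ENNReal.ofReal C * ENNReal.ofReal (‖charFun μ ξ‖ ^ 2 * ‖ξ‖ ^ (s - d)) =
        ENNReal.ofReal (‖charFun μ ξ‖ ^ 2) * ENNReal.ofReal (C * ‖ξ‖ ^ (2 * a + 2)) := by
      rw [← ENNReal.ofReal_mul hC0.le, ← ENNReal.ofReal_mul (by positivity),
        show 2 * a + 2 = s - d by rw [ha]; ring]
      congr 1; ring
    rw [h']
    refine (mul_le_mul_right h _).trans ?_
    rw [← lintegral_const_mul _ (by fun_prop)]
    refine (setLIntegral_congr_fun measurableSet_Ioi fun t ht => ?_).le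
    have ht0 : (0 : ℝ) < t := ht
    rw [← ENNReal.ofReal_mul (by positivity), ← ENNReal.ofReal_mul (by positivity)]
    congr 1; ring
  have h2 : ∫⁻ ξ, ∫⁻ t in Ioi (0 : ℝ), ENNReal.ofReal (t ^ a) *
        ENNReal.ofReal (‖charFun μ ξ‖ ^ 2 * Real.exp (-t⁻¹ * ‖ξ‖ ^ 2)) =
      ENNReal.ofReal (Real.pi ^ (d / 2)) * ∫⁻ x, ∫⁻ y, (∫⁻ t in Ioi (0 : ℝ),
        ENNReal.ofReal (t ^ (s / 2 - 1) * Real.exp (-(‖x - y‖ ^ 2 / 4 * t)))) ∂μ ∂μ := by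
    rw [lintegral_lintegral_swap (Measurable.aemeasurable (by fun_prop))]
    have h3 : ∀ t ∈ Ioi (0 : ℝ), ∫⁻ ξ, ENNReal.ofReal (t ^ a) *
        ENNReal.ofReal (‖charFun μ ξ‖ ^ 2 * Real.exp (-t⁻¹ * ‖ξ‖ ^ 2)) =
        ENNReal.ofReal (Real.pi ^ (d / 2)) * ∫⁻ x, ∫⁻ y,
        ENNReal.ofReal (t ^ (s / 2 - 1) * Real.exp (-(‖x - y‖ ^ 2 / 4 * t))) ∂μ ∂μ := by
      intro t ht
      have ht0 : (0 : ℝ) < t := ht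
      rw [lintegral_const_mul _ (by fun_prop), lintegral_norm_charFun_sq_mul_exp μ ht0,
        ← mul_assoc, ← ENNReal.ofReal_mul (by positivity), ← hd]
      rw [show t ^ a * (Real.pi * t) ^ (d / 2) = Real.pi ^ (d / 2) * t ^ (s / 2 - 1) by
        rw [Real.mul_rpow Real.pi_pos.le ht0.le, mul_left_comm, ← Real.rpow_add ht0]
        congr 2; rw [ha]; ring]
      rw [ENNReal.ofReal_mul (by positivity), mul_assoc]
      congr 1
      simp_rw [ENNReal.ofReal_mul (Real.rpow_nonneg ht0.le (s / 2 - 1))]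
      simp_rw [lintegral_const_mul' _ _ ENNReal.ofReal_ne_top]
    rw [setLIntegral_congr_fun measurableSet_Ioi h3, lintegral_const_mul _ (by fun_prop),
      lintegral_lintegral_swap (Measurable.aemeasurable (by fun_prop))]
    congr 1
    refine lintegral_congr fun x => ?_
    rw [lintegral_lintegral_swap (Measurable.aemeasurable (by fun_prop))]
  have h4 : ∀ x y : V, ∫⁻ t in Ioi (0 : ℝ),
      ENNReal.ofReal (t ^ (s / 2 - 1) * Real.exp (-(‖x - y‖ ^ 2 / 4 * t))) ≤
      ENNReal.ofReal (4 ^ (s / 2) * Real.Gamma (s / 2)) * edist x y ^ (-s) := by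
    intro x y
    have hG := Real.Gamma_pos_of_pos (half_pos hs)
    -- On the diagonal the kernel is $\infty$, so the bound is trivial.
    rcases eq_or_ne x y with rfl | hxy
    · rw [edist_self, ENNReal.zero_rpow_of_neg (by linarith), ENNReal.mul_top]
      · exact le_top
      · exact (ENNReal.ofReal_pos.2 (by positivity)).ne'
    · have hr : 0 < ‖x - y‖ := norm_pos_iff.2 (sub_ne_zero.2 hxy)
      rw [lintegral_rpow_mul_exp_neg_mul (half_pos hs) (by positivity), edist_dist,
        ENNReal.ofReal_rpow_of_pos (dist_pos.2 hxy), ← ENNReal.ofReal_mul (by positivity),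
        dist_eq_norm]
      refine ENNReal.ofReal_le_ofReal (le_of_eq ?_)
      rw [one_div_div, Real.div_rpow (by positivity) (by positivity), ← Real.rpow_natCast,
        ← Real.rpow_mul hr.le, Real.rpow_neg hr.le, show ((2 : ℕ) : ℝ) * (s / 2) = s by
          push_cast; ring]
      field_simp
  have h5 : ENNReal.ofReal C * ∫⁻ ξ, ENNReal.ofReal (‖charFun μ ξ‖ ^ 2 * ‖ξ‖ ^ (s - d)) < ⊤ := by
    refine (h1.trans_eq h2).trans_lt (ENNReal.mul_lt_top ENNReal.ofReal_lt_top ?_)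
    refine lt_of_le_of_lt (lintegral_mono fun x => lintegral_mono fun y => h4 x y) ?_
    simp_rw [lintegral_const_mul' _ _ ENNReal.ofReal_ne_top]
    exact ENNReal.mul_lt_top ENNReal.ofReal_lt_top hE
  exact (ENNReal.mul_lt_top_iff.1 h5).elim (fun h => h.2) (fun h => h.elim
    (fun h => absurd h (ENNReal.ofReal_pos.2 hC0).ne') (fun h => h ▸ ENNReal.zero_lt_top))

/-- If `μ` has finite `s`-energy with `s > 2m`, then `|ξ|^{m-d} μ̂(ξ)` is integrable. -/
theorem integrable_rpow_norm_mul_charFun [Nontrivial V] (μ : Measure V)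
    [IsFiniteMeasure μ] {s k : ℝ} (hk : 0 < k) (hks : 2 * k < s) (hsd : s < Module.finrank ℝ V)
    (hE : ∫⁻ x, ∫⁻ y, edist x y ^ (-s) ∂μ ∂μ < ⊤) :
    Integrable fun ξ : V => ((‖ξ‖ ^ (k - Module.finrank ℝ V) : ℝ) : ℂ) * charFun μ ξ := by
  set D := Module.finrank ℝ V with hD
  have hD0 : 0 < D := Module.finrank_pos
  -- Near $0$ bound $|\hat\mu|$ by the total mass; $r^{k-D}$ is integrable there since $k>0$. For
  -- $r>1$ split $r^{k-D}|\hat\mu|$ as $r^{(s-D)/2}|\hat\mu|\cdot r^{(2k-D-s)/2}$ and use $2xy\le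
  -- x^2+y^2$; the square of the last factor is integrable since $2k<s$.
  let f : ℝ → ℝ := fun r => if r ≤ 1 then r ^ (k - D) else r ^ (2 * k - D - s)
  have hf : Integrable fun ξ : V => f ‖ξ‖ := by
    rw [integrable_fun_norm_addHaar, ← hD, ← Ioc_union_Ioi_eq_Ioi (zero_le_one' ℝ)]
    refine IntegrableOn.union ?_ ?_
    · have : IntegrableOn (fun r : ℝ => r ^ (k - 1)) (Ioc 0 1) :=
        (intervalIntegrable_iff_integrableOn_Ioc_of_le zero_le_one).1
          (intervalIntegral.intervalIntegrable_rpow' (by linarith))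
      refine this.congr_fun (fun r hr => ?_) measurableSet_Ioc
      have hr0 : 0 < r := hr.1
      simp only [f, if_pos hr.2, smul_eq_mul]
      rw [← Real.rpow_natCast, ← Real.rpow_add hr0, Nat.cast_sub hD0]
      congr 1; push_cast; ring
    · have : IntegrableOn (fun r : ℝ => r ^ (2 * k - s - 1)) (Ioi 1) :=
        integrableOn_Ioi_rpow_of_lt (by linarith) one_pos
      refine this.congr_fun (fun r hr => ?_) measurableSet_Ioi
      have hr1 : 1 < r := hr
      have hr0 : 0 < r := one_pos.trans hr1
      simp only [f, if_neg (not_le.2 hr1), smul_eq_mul]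
      rw [← Real.rpow_natCast, ← Real.rpow_add hr0, Nat.cast_sub hD0]
      congr 1; push_cast; ring
  have hg : Integrable fun ξ : V => ‖charFun μ ξ‖ ^ 2 * ‖ξ‖ ^ (s - D) := by
    refine ⟨Measurable.aestronglyMeasurable (by fun_prop), ?_⟩
    rw [hasFiniteIntegral_iff_ofReal (ae_of_all _ fun ξ => by positivity)]
    exact lintegral_norm_charFun_sq_mul_rpow_lt_top μ (by linarith) hsd hE
  -- The single constant covers both ranges: the mass serves $r\le 1$, the summand $1$ serves $r>1$.
  refine ((hf.const_mul (μ.real univ + 1)).add hg).mono'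
    (Measurable.aestronglyMeasurable (by fun_prop)) ?_
  filter_upwards [Measure.ae_ne volume (0 : V)] with ξ hξ
  have hr : 0 < ‖ξ‖ := norm_pos_iff.2 hξ
  have hM := norm_charFun_le (μ := μ) ξ
  have hM0 : 0 ≤ μ.real univ := measureReal_nonneg
  rw [norm_mul, Complex.norm_real, Real.norm_of_nonneg (by positivity)]
  simp only [Pi.add_apply, f]
  set x := ‖charFun μ ξ‖ with hx
  have hx0 : 0 ≤ x := norm_nonneg _
  split_ifs with h
  · have h1 : 0 ≤ x ^ 2 * ‖ξ‖ ^ (s - D) := by positivity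
    have h2 : 0 ≤ ‖ξ‖ ^ (k - D) := by positivity
    nlinarith
  · set u := ‖ξ‖ ^ ((s - D) / 2) with hu
    set v := ‖ξ‖ ^ ((2 * k - D - s) / 2) with hv
    have e1 : ‖ξ‖ ^ (k - D) = u * v := by
      rw [hu, hv, ← Real.rpow_add hr]; congr 1; ring
    have e2 : ‖ξ‖ ^ (s - D) = u ^ 2 := by
      rw [hu, ← Real.rpow_natCast, ← Real.rpow_mul hr.le]; congr 1; push_cast; ring
    have e3 : ‖ξ‖ ^ (2 * k - D - s) = v ^ 2 := by
      rw [hv, ← Real.rpow_natCast, ← Real.rpow_mul hr.le]; congr 1; push_cast; ring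
    rw [e1, e2, e3]
    nlinarith [sq_nonneg (x * u - v), sq_nonneg v, mul_nonneg hM0 (sq_nonneg v),
      sq_nonneg (x * u)]

/-! ### Nonvanishing of the Riesz potential. -/

/-- The Riesz potential of a nonzero measure at the origin, in Fourier form, does not vanish. -/
theorem integral_rpow_norm_mul_charFun_ne_zero [Nontrivial V] (μ : Measure V)
    [IsFiniteMeasure μ] (hμ : μ ≠ 0) {k : ℝ} (hk : k < Module.finrank ℝ V)
    (hint : Integrable fun ξ : V =>
      ((‖ξ‖ ^ (k - Module.finrank ℝ V) : ℝ) : ℂ) * charFun μ ξ) :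
    ∫ ξ : V, ((‖ξ‖ ^ (k - Module.finrank ℝ V) : ℝ) : ℂ) * charFun μ ξ ≠ 0 := by
  set d : ℝ := (Module.finrank ℝ V : ℝ) with hd
  set a : ℝ := (d - k) / 2 with ha
  have ha0 : 0 < a := by rw [ha]; linarith
  have hG := Real.Gamma_pos_of_pos ha0
  -- Integrating in $t$ gives $\Gamma(a)|\xi|^{k-d}\hat\mu(\xi)$; integrating in $\xi$ first gives a
  -- positive number for every $t>0$.
  let F : V → ℝ → ℂ := fun ξ t =>
    charFun μ ξ * ((t ^ (a - 1) * Real.exp (-(‖ξ‖ ^ 2 * t)) : ℝ) : ℂ)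
  have hgam : ∀ ξ : V, ξ ≠ 0 → ∫ t in Ioi (0 : ℝ), t ^ (a - 1) * Real.exp (-(‖ξ‖ ^ 2 * t)) =
      Real.Gamma a * ‖ξ‖ ^ (k - d) := by
    intro ξ hξ
    have hr : 0 < ‖ξ‖ := norm_pos_iff.2 hξ
    rw [Real.integral_rpow_mul_exp_neg_mul_Ioi ha0 (by positivity), mul_comm, one_div,
      Real.inv_rpow (by positivity), ← Real.rpow_neg (by positivity), ← Real.rpow_natCast,
      ← Real.rpow_mul hr.le]
    congr 2; rw [ha]; push_cast; ring
  have hFi : ∀ ξ : V, ξ ≠ 0 → ∫ t in Ioi (0 : ℝ), F ξ t =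
      Real.Gamma a * (((‖ξ‖ ^ (k - d) : ℝ) : ℂ) * charFun μ ξ) := by
    intro ξ hξ
    simp only [F]
    rw [integral_const_mul, integral_complex_ofReal, hgam ξ hξ]
    push_cast; ring
  -- The Gaussian factors are positive, so integrating $|F|$ in $t$ gives back
  -- $\Gamma(a)|\xi|^{k-d}|\hat\mu|$, which is integrable by `hint`.
  have hF : Integrable (Function.uncurry F) (volume.prod (volume.restrict (Ioi (0 : ℝ)))) := by
    rw [integrable_prod_iff (Measurable.aestronglyMeasurable (by fun_prop))]
    constructor
    · filter_upwards [Measure.ae_ne volume (0 : V)] with ξ hξ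
      have hr : 0 < ‖ξ‖ := norm_pos_iff.2 hξ
      have : Integrable (fun t : ℝ => t ^ (a - 1) * Real.exp (-(‖ξ‖ ^ 2 * t)))
          (volume.restrict (Ioi 0)) := by
        refine Integrable.of_integral_ne_zero ?_
        rw [hgam ξ hξ]
        positivity
      exact this.ofReal.const_mul (charFun μ ξ)
    · refine (hint.norm.const_mul (Real.Gamma a)).congr ?_
      filter_upwards [Measure.ae_ne volume (0 : V)] with ξ hξ
      have hr : 0 < ‖ξ‖ := norm_pos_iff.2 hξ
      have : ∀ t ∈ Ioi (0 : ℝ), ‖Function.uncurry F (ξ, t)‖ =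
          ‖charFun μ ξ‖ * (t ^ (a - 1) * Real.exp (-(‖ξ‖ ^ 2 * t))) := by
        intro t ht
        have ht0 : (0 : ℝ) < t := ht
        simp only [Function.uncurry, F]
        rw [norm_mul, Complex.norm_real, Real.norm_of_nonneg (by positivity)]
      rw [setIntegral_congr_fun measurableSet_Ioi this, integral_const_mul, hgam ξ hξ, norm_mul,
        Complex.norm_real, Real.norm_of_nonneg (by positivity)]
      ring
  let h : ℝ → ℝ := fun t => t ^ (a - 1) * ((Real.pi / t) ^ (d / 2) *
    ∫ y, Real.exp (-(‖y‖ ^ 2 / (4 * t))) ∂μ)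
  have hFh : ∀ t ∈ Ioi (0 : ℝ), ∫ ξ, F ξ t = (h t : ℂ) := by
    intro t ht
    have := integral_charFun_mul_exp_neg_mul_sq μ (b := t) ht 0
    simp only [inner_zero_left, Complex.ofReal_zero, zero_mul, neg_zero, Complex.exp_zero,
      mul_one, sub_zero, ← hd] at this
    simp only [h]
    rw [Complex.ofReal_mul, ← this, ← integral_const_mul]
    refine integral_congr_ae (ae_of_all _ fun ξ => ?_)
    simp only [F]
    push_cast
    ring_nf
  have hpos : ∀ t ∈ Ioi (0 : ℝ), 0 < h t := by
    intro t ht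
    have ht0 : (0 : ℝ) < t := ht
    have : 0 < ∫ y, Real.exp (-(‖y‖ ^ 2 / (4 * t))) ∂μ := by
      have : NeZero μ := ⟨hμ⟩
      refine integral_exp_pos ?_
      refine (integrable_const (1 : ℝ)).mono' (by fun_prop) (ae_of_all _ fun y => ?_)
      rw [Real.norm_of_nonneg (by positivity), Real.exp_le_one_iff, neg_nonpos]
      positivity
    positivity
  have hhint : IntegrableOn h (Ioi 0) := by
    have h1 : Integrable (fun t => (∫ ξ, F ξ t).re) (volume.restrict (Ioi (0 : ℝ))) :=
      hF.integral_prod_right.re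
    refine h1.congr ?_
    filter_upwards [ae_restrict_mem measurableSet_Ioi] with t ht
    rw [hFh t ht, Complex.ofReal_re]
  have hI : 0 < ∫ t in Ioi (0 : ℝ), h t := by
    rw [setIntegral_pos_iff_support_of_nonneg_ae _ hhint]
    · have : Ioi (0 : ℝ) ⊆ Function.support h ∩ Ioi 0 := fun t ht => ⟨(hpos t ht).ne', ht⟩
      exact lt_of_lt_of_le (by simp) (measure_mono this)
    · filter_upwards [ae_restrict_mem measurableSet_Ioi] with t ht using (hpos t ht).le
  have hswap := integral_integral_swap hF
  rw [setIntegral_congr_fun measurableSet_Ioi hFh, integral_complex_ofReal,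
    integral_congr_ae (g := fun ξ => Real.Gamma a * (((‖ξ‖ ^ (k - d) : ℝ) : ℂ) * charFun μ ξ)) ?_,
    integral_const_mul] at hswap
  · intro h0
    rw [h0, mul_zero] at hswap
    exact hI.ne (by exact_mod_cast hswap)
  · filter_upwards [Measure.ae_ne volume (0 : V)] with ξ hξ using hFi ξ hξ

end Analysis

/-! ### Averaging over random planes. -/

namespace RieszProj

open Set Filter Topology

instance isHaarMeasure_haarO (n : ℕ) : (haarO n).IsHaarMeasure := by
  unfold haarO
  infer_instance

/-- A right translate of the left Haar measure is again a Haar probability measure, hence the same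
one by uniqueness. -/
instance isMulRightInvariant_haarO (n : ℕ) : (haarO n).IsMulRightInvariant where
  map_mul_right_eq_self k := by
    have : IsProbabilityMeasure ((haarO n).map (· * k)) :=
      Measure.isProbabilityMeasure_map (measurable_mul_const k).aemeasurable
    exact Measure.isHaarMeasure_eq_of_isProbabilityMeasure _ _

/-- The isometry `x ↦ gx` of `ℝⁿ`. -/
noncomputable def act {n : ℕ} (g : O n) : E n →ₗᵢ[ℝ] E n where
  toLinearMap := Matrix.toEuclideanLin (g : Matrix (Fin n) (Fin n) ℝ)
  norm_map' x := by
    let T := Matrix.toEuclideanCLM (n := Fin n) (𝕜 := ℝ)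
    change ‖T g.1 x‖ = ‖x‖
    rw [← sq_eq_sq₀ (norm_nonneg _) (norm_nonneg _), ← real_inner_self_eq_norm_sq,
      ← real_inner_self_eq_norm_sq, ← ContinuousLinearMap.adjoint_inner_right,
      ← ContinuousLinearMap.star_eq_adjoint, ← map_star T]
    have h : T (star g.1) * T g.1 = 1 := by
      rw [← map_mul, Unitary.star_mul_self_of_mem g.2, map_one]
    exact congrArg (inner ℝ x) (DFunLike.congr_fun h x)

theorem act_mul {n : ℕ} (g h : O n) (x : E n) : act (g * h) x = act g (act h x) := by
  change Matrix.toEuclideanCLM (n := Fin n) (𝕜 := ℝ) (g.1 * h.1) x = _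
  rw [map_mul]
  rfl

theorem continuous_act {n : ℕ} : Continuous fun p : O n × E n => act p.1 p.2 := by
  change Continuous fun p : O n × E n => WithLp.toLp 2 (p.1.1.mulVec p.2.ofLp)
  fun_prop

/-- The reflection in the hyperplane orthogonal to $x-y$ carries $x$ to $y$. -/
theorem exists_act_eq {n : ℕ} {x y : E n} (h : ‖x‖ = ‖y‖) : ∃ g : O n, act g x = y := by
  let b := EuclideanSpace.basisFun (Fin n) ℝ
  let f : E n ≃ₗᵢ[ℝ] E n := Submodule.reflection (ℝ ∙ (x - y))ᗮ
  refine ⟨⟨_, f.toMatrix_mem_unitaryGroup b b⟩, ?_⟩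
  have : act ⟨_, f.toMatrix_mem_unitaryGroup b b⟩ x = f x := by
    ext i
    change (Matrix.mulVec (LinearMap.toMatrix b.toBasis b.toBasis f.toLinearMap) (b.toBasis.repr x)) i = _
    rw [LinearMap.toMatrix_mulVec_repr]
    rfl
  rw [this]
  exact Submodule.reflection_sub h

theorem lintegral_act_eq_of_norm_eq {n : ℕ} (f : E n → ENNReal) {x y : E n} (h : ‖x‖ = ‖y‖) :
    ∫⁻ g, f (act g x) ∂haarO n = ∫⁻ g, f (act g y) ∂haarO n := by
  obtain ⟨k, rfl⟩ := exists_act_eq h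
  simp_rw [← act_mul]
  exact (lintegral_mul_right_eq_self (fun g => f (act g x)) k).symm

theorem toSphere_univ_ne_zero (d : ℕ) [NeZero d] :
    (volume : Measure (E d)).toSphere univ ≠ 0 := by
  simp [Measure.toSphere_apply_univ, NeZero.ne d,
    (Metric.measure_ball_pos volume (0 : E d) one_pos).ne']

/-- The mean of `f` over the sphere of radius `r`. -/
noncomputable def sphereMean {n : ℕ} [NeZero n] (f : E n → ENNReal) (r : ℝ) : ENNReal :=
  ∫⁻ g, f (act g (r • EuclideanSpace.single (0 : Fin n) (1 : ℝ))) ∂haarO n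

theorem measurable_sphereMean {n : ℕ} [NeZero n] {f : E n → ENNReal} (hf : Measurable f) :
    Measurable (sphereMean f) := by
  let e : E n := EuclideanSpace.single 0 1
  have h : Continuous fun p : ℝ × O n => act p.2 (p.1 • e) :=
    continuous_act.comp (by fun_prop : Continuous fun p : ℝ × O n => (p.2, p.1 • e))
  have h1 : Measurable fun p : ℝ × O n => f (act p.2 (p.1 • e)) := hf.comp h.measurable
  have h2 : Measurable fun r : ℝ => ∫⁻ g, f (act g (r • e)) ∂haarO n := h1.lintegral_prod_right'
  exact h2

theorem lintegral_act_eq_sphereMean {n : ℕ} [NeZero n] (f : E n → ENNReal) (x : E n) :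
    ∫⁻ g, f (act g x) ∂haarO n = sphereMean f ‖x‖ :=
  lintegral_act_eq_of_norm_eq f (by simp [norm_smul])

theorem measurable_act_comp {n m : ℕ} (ι : E m →ₗᵢ[ℝ] E n) :
    Measurable fun p : O n × E m => act p.1 (ι p.2) :=
  (continuous_act.comp (by fun_prop : Continuous fun p : O n × E m => (p.1, ι p.2))).measurable

/-- After exchanging the integrals, the average over $g$ depends only on $|u|$, so polar coordinates
in $\mathbb{R}^m$ apply. -/
theorem lintegral_lintegral_act_eq {n m : ℕ} [NeZero n] [NeZero m] (ι : E m →ₗᵢ[ℝ] E n)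
    {f : E n → ENNReal} (hf : Measurable f) :
    ∫⁻ g, (∫⁻ u, f (act g (ι u))) ∂haarO n = (volume : Measure (E m)).toSphere univ *
      ∫⁻ r in Ioi (0 : ℝ), ENNReal.ofReal (r ^ (m - 1)) * sphereMean f r := by
  have h := lintegral_lintegral_swap (μ := haarO n) (ν := (volume : Measure (E m)))
    (f := fun g u => f (act g (ι u))) (hf.comp (measurable_act_comp ι)).aemeasurable
  rw [h]
  simp_rw [lintegral_act_eq_sphereMean, ι.norm_map]
  rw [lintegral_fun_norm_addHaar (measurable_sphereMean hf), finrank_euclideanSpace_fin]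

/-- Lebesgue measure and the weight are rotation invariant, so $f$ may be replaced by its spherical
means. Comparison with the preceding formula for planes produces the weight $r^{m-n}$. -/
theorem lintegral_fun_norm_mul_eq {n : ℕ} [NeZero n] {f : E n → ENNReal} (hf : Measurable f)
    {w : ℝ → ENNReal} (hw : Measurable w) :
    ∫⁻ ξ, w ‖ξ‖ * f ξ = (volume : Measure (E n)).toSphere univ *
      ∫⁻ r in Ioi (0 : ℝ), ENNReal.ofReal (r ^ (n - 1)) * (w r * sphereMean f r) := by
  have hF : Measurable fun ξ : E n => w ‖ξ‖ * f ξ := by fun_prop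
  have hrot : ∀ g : O n, ∫⁻ ξ, w ‖ξ‖ * f (act g ξ) = ∫⁻ ξ, w ‖ξ‖ * f ξ := by
    intro g
    rw [← ((act g).toLinearIsometryEquiv rfl).measurePreserving.lintegral_comp hF]
    simp only [LinearIsometry.coe_toLinearIsometryEquiv, LinearIsometry.norm_map]
  have hmean : ∀ ξ : E n, ∫⁻ g, w ‖ξ‖ * f (act g ξ) ∂haarO n = w ‖ξ‖ * sphereMean f ‖ξ‖ := by
    intro ξ
    have : Measurable fun g : O n => f (act g ξ) := hf.comp
      (continuous_act.comp (by fun_prop : Continuous fun g : O n => (g, ξ))).measurable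
    rw [lintegral_const_mul _ this, lintegral_act_eq_sphereMean]
  have hswap : ∫⁻ g, (∫⁻ ξ, w ‖ξ‖ * f (act g ξ)) ∂haarO n =
      ∫⁻ ξ, ∫⁻ g, w ‖ξ‖ * f (act g ξ) ∂haarO n := by
    refine lintegral_lintegral_swap (Measurable.aemeasurable ?_)
    exact (hw.comp (by fun_prop : Measurable fun p : O n × E n => ‖p.2‖)).mul
      (hf.comp continuous_act.measurable)
  simp only [hrot, hmean, lintegral_const, measure_univ, mul_one] at hswap
  have hs := measurable_sphereMean hf
  rw [hswap, lintegral_fun_norm_addHaar (f := fun r => w r * sphereMean f r) (by fun_prop),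
    finrank_euclideanSpace_fin]

/-- Integration over a random `m`-plane, parametrized isometrically by `ι`, is integration over
`ℝⁿ` against `|ξ|^{m-n}`. -/
theorem exists_lintegral_lintegral_act_eq {n m : ℕ} (hm : 0 < m) (ι : E m →ₗᵢ[ℝ] E n) :
    ∃ c : ENNReal, c ≠ 0 ∧ c ≠ ⊤ ∧ ∀ f : E n → ENNReal, Measurable f →
      ∫⁻ g, (∫⁻ u, f (act g (ι u))) ∂haarO n =
        c * ∫⁻ ξ, ENNReal.ofReal (‖ξ‖ ^ ((m : ℝ) - n)) * f ξ := by
  have : NeZero m := ⟨hm.ne'⟩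
  have hmn : m ≤ n := by
    simpa using LinearMap.finrank_le_finrank_of_injective (f := ι.toLinearMap) ι.injective
  have : NeZero n := ⟨(hm.trans_le hmn).ne'⟩
  -- The constant is the ratio of the surface measures of the unit spheres of $\mathbb{R}^m$ and
  -- $\mathbb{R}^n$.
  refine ⟨(volume : Measure (E m)).toSphere univ / (volume : Measure (E n)).toSphere univ,
    ENNReal.div_ne_zero.2 ⟨toSphere_univ_ne_zero m, measure_ne_top _ _⟩,
    ENNReal.div_ne_top (measure_ne_top _ _) (toSphere_univ_ne_zero n), fun f hf => ?_⟩
  rw [lintegral_lintegral_act_eq ι hf, lintegral_fun_norm_mul_eq hf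
    (w := fun r => ENNReal.ofReal (r ^ ((m : ℝ) - n))) (by fun_prop), ← mul_assoc,
    ENNReal.div_mul_cancel (toSphere_univ_ne_zero n) (measure_ne_top _ _)]
  congr 1
  refine setLIntegral_congr_fun measurableSet_Ioi fun r hr => ?_
  have hr0 : (0 : ℝ) < r := hr
  rw [← mul_assoc, ← ENNReal.ofReal_mul (by positivity), ← Real.rpow_natCast,
    ← Real.rpow_natCast, ← Real.rpow_add hr0, Nat.cast_sub hm,
    Nat.cast_sub (hm.trans_le hmn : 1 ≤ n)]
  congr 3; push_cast; ring

/-- The law of `g ι(u)` under `θ_n × ℒ^m`. -/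
theorem exists_map_act_eq {n m : ℕ} (hm : 0 < m) (ι : E m →ₗᵢ[ℝ] E n) :
    ∃ c : ENNReal, c ≠ 0 ∧ c ≠ ⊤ ∧
      ((haarO n).prod (volume : Measure (E m))).map (fun p => act p.1 (ι p.2)) =
        c • (volume : Measure (E n)).withDensity
          fun ξ => ((‖ξ‖ ^ ((m : ℝ) - n)).toNNReal : ENNReal) := by
  obtain ⟨c, hc0, hc, h⟩ := exists_lintegral_lintegral_act_eq hm ι
  have hφ := measurable_act_comp ι
  refine ⟨c, hc0, hc, Measure.ext_of_lintegral _ fun f hf => ?_⟩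
  have hp := lintegral_prod (μ := haarO n) (ν := (volume : Measure (E m))) _
    (hf.comp hφ).aemeasurable
  simp only [Function.comp_apply] at hp
  rw [lintegral_map hf hφ, hp, h f hf, lintegral_smul_measure, lintegral_withDensity_eq_lintegral_mul _ (by fun_prop) hf]
  rfl

/-! ### Projections in isometric coordinates. -/

/-- The isometric embedding of `ℝᵐ` onto the span of the first `m` coordinate vectors. -/
noncomputable def incl {n m : ℕ} (h : m ≤ n) : E m →ₗᵢ[ℝ] E n :=
  LinearMap.isometryOfOrthonormal
    ((EuclideanSpace.basisFun (Fin m) ℝ).toBasis.constr ℝ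
      fun i => EuclideanSpace.single (Fin.castLE h i) (1 : ℝ))
    (v := (EuclideanSpace.basisFun (Fin m) ℝ).toBasis)
    (by simp)
    (by
      have := (EuclideanSpace.orthonormal_single (𝕜 := ℝ) (ι := Fin n)).comp
        _ (Fin.castLE_injective h)
      convert this using 1
      ext1 i
      simp only [Function.comp_apply]
      rw [Module.Basis.constr_basis])

theorem range_incl {n m : ℕ} (h : m ≤ n) :
    LinearMap.range (incl h).toLinearMap = (Gr.base h).1 :=
  Module.Basis.constr_range _ _

theorem range_act_comp_incl {n m : ℕ} (h : m ≤ n) (g : O n) :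
    LinearMap.range ((act g).comp (incl h)).toLinearMap = (Gr.rotate g (Gr.base h)).1 := by
  change LinearMap.range ((act g).toLinearMap ∘ₗ (incl h).toLinearMap) = _
  rw [LinearMap.range_comp, range_incl]
  rfl

open ContinuousLinearMap in
/-- Interior points of a projection onto a subspace can be computed in isometric coordinates. -/
theorem zero_mem_interior_image_orthogonalProjectionOnto {n m : ℕ} (T : E m →ₗᵢ[ℝ] E n)
    {W : Submodule ℝ (E n)} (hT : LinearMap.range T.toLinearMap = W) {S : Set (E n)}
    (h : (0 : E m) ∈ interior (adjoint T.toContinuousLinearMap '' S)) :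
    (0 : W) ∈ interior (W.orthogonalProjectionOnto '' S) := by
  subst hT
  let φ := T.equivRange
  -- For an isometry $T$, the operator $TT^*$ is the orthogonal projection onto the range of $T$.
  -- Hence the projection is $T^*$ followed by the homeomorphism `φ`.
  have hφ : ∀ x : E n, (LinearMap.range T.toLinearMap).orthogonalProjectionOnto x =
      φ (adjoint T.toContinuousLinearMap x) := by
    intro x
    refine Subtype.ext (Submodule.eq_starProjection_of_mem_of_inner_eq_zero
      (φ (adjoint T.toContinuousLinearMap x)).2 ?_)
    rintro _ ⟨w, rfl⟩
    change inner ℝ (x - T (adjoint T.toContinuousLinearMap x)) (T w) = 0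
    rw [inner_sub_left, T.inner_map_map, adjoint_inner_left]
    exact sub_self _
  have himg : (LinearMap.range T.toLinearMap).orthogonalProjectionOnto '' S =
      φ.toHomeomorph '' (adjoint T.toContinuousLinearMap '' S) := by
    rw [image_image]
    exact image_congr fun x _ => hφ x
  rw [himg, ← φ.toHomeomorph.image_interior]
  exact ⟨0, h, map_zero φ⟩

open ContinuousLinearMap in
-- Since $\langle T^*x,u\rangle=\langle x,Tu\rangle$, projecting the measure restricts its transform
-- to the plane.
theorem charFun_map_adjoint {n m : ℕ} (T : E m →ₗᵢ[ℝ] E n) (μ : Measure (E n)) (u : E m) :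
    charFun (μ.map (adjoint T.toContinuousLinearMap)) u = charFun μ (T u) := by
  rw [charFun_apply, charFun_apply, integral_map (by fun_prop)
    (Measurable.aestronglyMeasurable (by fun_prop))]
  simp_rw [adjoint_inner_left]
  rfl

/-- If the restriction of the characteristic function of `μ` to the plane `T(ℝᵐ)` is integrable
with nonzero integral, the projection of `spt μ` to this plane contains a neighborhood of `0`. -/
theorem zero_mem_interior_of_integral_charFun_comp_ne_zero {n m : ℕ} (T : E m →ₗᵢ[ℝ] E n)
    {W : Submodule ℝ (E n)} (hT : LinearMap.range T.toLinearMap = W) (μ : Measure (E n))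
    [IsFiniteMeasure μ] (hμ : IsCompact μ.support)
    (hint : Integrable fun u => charFun μ (T u)) (h0 : ∫ u, charFun μ (T u) ≠ 0) :
    (0 : W) ∈ interior (W.orthogonalProjectionOnto '' μ.support) := by
  refine zero_mem_interior_image_orthogonalProjectionOnto T hT ?_
  set A := ContinuousLinearMap.adjoint T.toContinuousLinearMap with hA
  have hchar : charFun (μ.map A) = fun u => charFun μ (T u) :=
    funext fun u => charFun_map_adjoint T μ u
  have hK : IsClosed (A '' μ.support) := (hμ.image A.continuous).isClosed
  refine zero_mem_interior_of_integral_charFun_ne_zero (μ.map A) (hchar ▸ hint) (hchar ▸ h0) hK ?_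
  rw [Measure.map_apply A.continuous.measurable hK.isOpen_compl.measurableSet]
  exact measure_mono_null (fun x hx hxs => hx ⟨x, hxs, rfl⟩) Measure.measure_compl_support

/-! ### Assembly of the proof. -/

/-- The characteristic function of a measure of finite `s`-energy, `s > 2m`, is integrable on
almost every `m`-plane, and its integral does not vanish almost everywhere. -/
theorem integrable_charFun_act {n m : ℕ} (hm : 0 < m) (ι : E m →ₗᵢ[ℝ] E n) {s : ℝ}
    (hms : 2 * (m : ℝ) < s) (hsn : s < n) (μ : Measure (E n)) [IsFiniteMeasure μ] (hμ : μ ≠ 0)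
    (hE : energy s μ < ⊤) :
    Integrable (fun p : O n × E m => charFun μ (act p.1 (ι p.2))) ((haarO n).prod volume) ∧
      ∫ p : O n × E m, charFun μ (act p.1 (ι p.2)) ∂(haarO n).prod volume ≠ 0 := by
  have hm0 : (0 : ℝ) < m := Nat.cast_pos.2 hm
  have hn0 : (0 : ℝ) < n := by linarith
  have : NeZero n := ⟨(Nat.cast_pos.1 hn0).ne'⟩
  have hfin : (Module.finrank ℝ (E n) : ℝ) = n := by rw [finrank_euclideanSpace_fin]
  have hint := integrable_rpow_norm_mul_charFun μ hm0 hms (hfin.symm ▸ hsn) hE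
  have hne := integral_rpow_norm_mul_charFun_ne_zero μ hμ (k := m)
    (by rw [hfin]; linarith) hint
  rw [hfin] at hint hne
  obtain ⟨c, hc0, hc, hmap⟩ := exists_map_act_eq hm ι
  have hφ := measurable_act_comp ι
  have hw : Measurable fun ξ : E n => (‖ξ‖ ^ ((m : ℝ) - n)).toNNReal := by fun_prop
  have hsm : ∀ ξ : E n, (‖ξ‖ ^ ((m : ℝ) - n)).toNNReal • charFun μ ξ =
      ((‖ξ‖ ^ ((m : ℝ) - n) : ℝ) : ℂ) * charFun μ ξ := by
    intro ξ
    rw [NNReal.smul_def, Real.coe_toNNReal _ (by positivity), Complex.real_smul]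
  have hc' : AEStronglyMeasurable (charFun μ)
      (((haarO n).prod (volume : Measure (E m))).map fun p => act p.1 (ι p.2)) :=
    measurable_charFun.aestronglyMeasurable
  constructor
  · refine (integrable_map_measure hc' hφ.aemeasurable).1 ?_
    rw [hmap]
    refine Integrable.smul_measure ?_ hc
    rw [integrable_withDensity_iff_integrable_smul hw]
    simpa only [hsm] using hint
  · rw [← integral_map hφ.aemeasurable hc', hmap, integral_smul_measure,
      integral_withDensity_eq_integral_smul hw]
    simp only [hsm]
    exact smul_ne_zero (ENNReal.toReal_ne_zero.2 ⟨hc0, hc⟩) hne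

/-- Settles $m=0$, which the Fourier argument excludes since it needs a positive exponent and polar
coordinates in $\mathbb{R}^m$. -/
theorem zero_mem_interior_of_finrank_eq_zero {n : ℕ} (V : Gr n 0) {S : Set (E n)}
    (hS : S.Nonempty) : (0 : V.1) ∈ interior (V.1.orthogonalProjectionOnto '' S) := by
  have : Subsingleton V.1 := Module.finrank_zero_iff.1 V.2
  obtain ⟨x, hx⟩ := hS
  rw [mem_interior_iff_mem_nhds]
  exact Filter.mem_of_superset Filter.univ_mem fun y _ => ⟨x, hx, Subsingleton.elim _ _⟩

end RieszProj

theorem mainTheorem7 (n m : ℕ) (s : ℝ) (hms : 2 * (m : ℝ) < s) (hsn : s < (n : ℝ))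
    (μ : MeasureTheory.Measure (EuclideanSpace ℝ (Fin n)))
    (hμ_pos : 0 < μ Set.univ) (hμ_fin : μ Set.univ < ⊤) (hμ_supp : IsCompact μ.support)
    (hμ_energy : RieszProj.energy s μ < ⊤) :
    0 < RieszProj.gammaGr n m {V : RieszProj.Gr n m |
      (0 : V.1) ∈ interior (V.1.orthogonalProjectionOnto '' μ.support)} := by
  have : IsFiniteMeasure μ := ⟨hμ_fin⟩
  have hμ : μ ≠ 0 := fun h => by simp [h] at hμ_pos
  have hm0 : (0 : ℝ) ≤ m := Nat.cast_nonneg m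
  have hmn : m ≤ n := Nat.cast_le.1 (by linarith : (m : ℝ) ≤ n)
  have := RieszProj.isProbabilityMeasure_gammaGr hmn
  rcases Nat.eq_zero_or_pos m with rfl | hm
  · refine (one_pos.trans_eq (measure_univ (μ := RieszProj.gammaGr n 0)).symm).trans_le
      (measure_mono fun V _ => ?_)
    exact RieszProj.zero_mem_interior_of_finrank_eq_zero V (Measure.nonempty_support hμ)
  · obtain ⟨hint, hne⟩ :=
      RieszProj.integrable_charFun_act hm (RieszProj.incl hmn) hms hsn μ hμ hμ_energy
    rw [RieszProj.gammaGr, dif_pos hmn, pos_iff_ne_zero]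
    -- If the set of good planes were null, the integral of $\hat\mu$ over $gV_0$ would vanish for
    -- almost every $g$, and Fubini would contradict `hne`.
    intro h0
    have h1 : ∀ᵐ g ∂(RieszProj.haarO n),
        ∫ u, charFun μ (RieszProj.act g (RieszProj.incl hmn u)) = 0 := by
      -- `Measure.le_map_apply` holds for arbitrary sets, so measurability of the set of good planes
      -- is not needed.
      have h2 := le_zero_iff.1 ((Measure.le_map_apply
        (RieszProj.Gr.continuous_rotate (RieszProj.Gr.base hmn)).measurable.aemeasurable _).trans
        h0.le)
      filter_upwards [measure_eq_zero_iff_ae_notMem.1 h2, hint.prod_right_ae] with g hg hgi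
      by_contra hne'
      exact hg (RieszProj.zero_mem_interior_of_integral_charFun_comp_ne_zero
        ((RieszProj.act g).comp (RieszProj.incl hmn)) (RieszProj.range_act_comp_incl hmn g)
        μ hμ_supp hgi hne')
    apply hne
    rw [integral_prod _ hint, integral_congr_ae h1, integral_zero]
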